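/- Let $d\ge 1$ be an integer and $p>1$. For $s\in(0,1)$ and measurable $u:\mathbb{R}^d\to\mathbb{R}$ put $$[u]_{W^{s,p}}^p=\int_{\mathbb{R}^d}\int_{\mathbb{R}^d}\frac{|u(x)-u(y)|^p}{|x-y|^{d+sp}}\,dx\,dy ,$$ and let $W^{s,p}(\mathbb{R}^d)$ be the completion of $C_c^\infty(\mathbb{R}^d)$ under the norm $\big(\|u\|_{L^p}^p+[u]_{W^{s,p}}^p\big)^{1/p}$, regarded as a space of functions in $L^p(\mathbb{R}^d)$. There is a constant $C(d,p)>0$, depending only on $d$ and $p$, such that for every $s\in(0,1)$ with $sp<d$ and every $u\in W^{s,p}(\mathbb{R}^d)$ with $\int_{\mathbb{R}^d}|u(x)|^p\,dx=1$ one has $0<[u]_{W^{s,p}}^p<\infty$, the positive part of $|u|^p\log|u|$ is integrable (with the convention $0^p\log 0=0$), and $$\int_{\mathbb{R}^d}|u(x)|^p\log|u(x)|\,dx\;\le\;\frac{d}{sp^2}\,\log\!\big(\mathcal{C}\,[u]_{W^{s,p}}^p\big),\qquad \mathcal{C}=C(d,p)\,\frac{s(1-s)}{(d-sp)^{p-1}},$$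 where the left-hand side is understood as an extended real number and may equal $-\infty$. -/

import Mathlib

open MeasureTheory Filter Topology
open scoped ENNReal ContDiff

noncomputable section

/-- The `p`-th power of the Gagliardo seminorm of `u : ℝᵈ → ℝ`,
`∫ ∫ |u x - u y| ^ p / |x - y| ^ (d + s p) dx dy`, with values in `[0, ∞]`. -/
def gagliardoEnergy {d : ℕ} (s p : ℝ) (u : EuclideanSpace ℝ (Fin d) → ℝ) : ℝ≥0∞ :=
  ∫⁻ y, ∫⁻ x, ENNReal.ofReal (|u x - u y| ^ p / ‖x - y‖ ^ ((d : ℝ) + s * p))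

/-- The norm `(‖u‖_p ^ p + [u]_{s,p} ^ p) ^ (1 / p)`, with values in `[0, ∞]`. -/
def fracSobolevNorm {d : ℕ} (s p : ℝ) (u : EuclideanSpace ℝ (Fin d) → ℝ) : ℝ≥0∞ :=
  (eLpNorm u (ENNReal.ofReal p) volume ^ p + gagliardoEnergy s p u) ^ (1 / p)

/-- Membership in `W^{s,p}(ℝᵈ)`, the completion of the smooth compactly supported functions
under `fracSobolevNorm`, realised inside `L^p`: the functions in `L^p` which are limits
of smooth compactly supported functions in that norm. -/
def MemFracSobolev {d : ℕ} (s p : ℝ) (u : EuclideanSpace ℝ (Fin d) → ℝ) : Prop :=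
  MemLp u (ENNReal.ofReal p) volume ∧
    ∃ φ : ℕ → EuclideanSpace ℝ (Fin d) → ℝ,
      (∀ n, ContDiff ℝ ∞ (φ n) ∧ HasCompactSupport (φ n)) ∧
      Tendsto (fun n => fracSobolevNorm s p (fun x => u x - φ n x)) atTop (𝓝 0)

/-- The integral `∫ f⁺ - ∫ f⁻` as an extended real number, allowing the value `-∞`.
It is meaningful when `∫ f⁺` is finite. -/
def extIntegral {d : ℕ} (f : EuclideanSpace ℝ (Fin d) → ℝ) : EReal :=
  ((∫⁻ x, ENNReal.ofReal (f x) : ℝ≥0∞) : EReal) - ((∫⁻ x, ENNReal.ofReal (-f x) : ℝ≥0∞) : EReal)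

end

/-! If `|u x| ^ p` exceeds `2 ^ p / V`, where `V` is the volume of an annulus of radius `r`, then
averaging `|u (x + h)| ^ p` over that annulus cannot account for its size, because the total mass is
one. The increments `u (x + h) - u x` must therefore carry it, and the mass of this level set is
controlled by the increments at scale `r` (`setLIntegral_level_le`). The scales `r / 2 ^ j` give
thresholds `T * 2 ^ (j d)`, and summing the masses above them bounds the integral of `|u| ^ p * log
(|u| ^ p / T)` (`ofReal_mul_log_div_le`).

The same increments, weighted by `2 ^ (j s p)`, bound the energy from below
(`tsum_annulusEnergy_le`). By the triangle inequality they decay at most like `2 ^ (-p j)` once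
normalised by volume, so the unweighted sum is at most a constant times `1 - s` times the weighted
one (`tsum_le_one_sub_mul_tsum`). This is the source of the factor `1 - s`.

The resulting entropy estimate (`exists_lintegral_mul_log_le`) holds at every scale `r`; the choice
`r ^ (s p) = (s (1 - s) E)⁻¹` yields the logarithm. The factor `(d - s p) ^ (1 - p)` costs nothing,
since `d / (d - s p) ≥ 1`. -/

noncomputable section

variable {d : ℕ} {p : ℝ} {u : EuclideanSpace ℝ (Fin d) → ℝ}

/-! ### Increments over annuli and their doubling -/

/-- The `p`-th power of the `L^p` norm of the increment `x ↦ u (x + h) - u x`. -/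
def shiftEnergy (p : ℝ) (u : EuclideanSpace ℝ (Fin d) → ℝ) (h : EuclideanSpace ℝ (Fin d)) :
    ℝ≥0∞ :=
  ∫⁻ x, ENNReal.ofReal (|u (x + h) - u x| ^ p)

/-- The annulus `{h | r / 2 < ‖h‖ ≤ r}`. -/
def annulus (d : ℕ) (r : ℝ) : Set (EuclideanSpace ℝ (Fin d)) :=
  {h | r / 2 < ‖h‖ ∧ ‖h‖ ≤ r}

/-- The integral of `shiftEnergy p u` over an annulus. -/
def annulusEnergy (p : ℝ) (u : EuclideanSpace ℝ (Fin d) → ℝ) (r : ℝ) : ℝ≥0∞ :=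
  ∫⁻ h in annulus d r, shiftEnergy p u h

theorem abs_add_rpow_le (hp : 1 ≤ p) (a b : ℝ) :
    |a + b| ^ p ≤ 2 ^ (p - 1) * (|a| ^ p + |b| ^ p) := by
  have h1 : |a + b| ^ p ≤ (|a| + |b|) ^ p :=
    Real.rpow_le_rpow (abs_nonneg _) (abs_add_le a b) (by linarith)
  refine h1.trans ?_
  have := NNReal.rpow_add_le_mul_rpow_add_rpow ⟨|a|, abs_nonneg a⟩ ⟨|b|, abs_nonneg b⟩ hp
  exact_mod_cast this

theorem measurableSet_annulus (r : ℝ) : MeasurableSet (annulus d r) :=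
  (measurableSet_lt measurable_const measurable_norm).inter
    (measurableSet_le measurable_norm measurable_const)

theorem measurable_increment (hu : Measurable u) :
    Measurable fun z : EuclideanSpace ℝ (Fin d) × EuclideanSpace ℝ (Fin d) =>
      ENNReal.ofReal (|u (z.2 + z.1) - u z.2| ^ p) := by
  have h1 : Measurable fun z : EuclideanSpace ℝ (Fin d) × EuclideanSpace ℝ (Fin d) =>
      u (z.2 + z.1) := hu.comp (measurable_snd.add measurable_fst)
  have h2 : Measurable fun z : EuclideanSpace ℝ (Fin d) × EuclideanSpace ℝ (Fin d) =>
      u z.2 := hu.comp measurable_snd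
  fun_prop

theorem measurable_shiftEnergy (hu : Measurable u) : Measurable (shiftEnergy p u) :=
  (measurable_increment hu).lintegral_prod_right'

theorem smul_annulus {c : ℝ} (hc : 0 < c) (r : ℝ) :
    (fun h : EuclideanSpace ℝ (Fin d) => c • h) ⁻¹' annulus d (c * r) = annulus d r := by
  ext h
  simp only [annulus, Set.mem_preimage, Set.mem_ofPred_eq, norm_smul, Real.norm_eq_abs,
    abs_of_pos hc]
  rw [mul_div_assoc, mul_lt_mul_iff_right₀ hc, mul_le_mul_iff_right₀ hc]

theorem setLIntegral_annulus_smul {f : EuclideanSpace ℝ (Fin d) → ℝ≥0∞} (hf : Measurable f)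
    {c : ℝ} (hc : 0 < c) (r : ℝ) :
    ∫⁻ h in annulus d (c * r), f h =
      ENNReal.ofReal (c ^ d) * ∫⁻ h in annulus d r, f (c • h) := by
  have hm : Measurable fun h : EuclideanSpace ℝ (Fin d) => c • h := measurable_const_smul c
  have h1 := Measure.map_addHaar_smul (volume : Measure (EuclideanSpace ℝ (Fin d))) hc.ne'
  have h2 : ∫⁻ h in annulus d r, f (c • h) =
      ENNReal.ofReal ((c ^ d)⁻¹) * ∫⁻ h in annulus d (c * r), f h := by
    rw [← smul_annulus hc r, ← setLIntegral_map (measurableSet_annulus _) hf hm, h1]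
    simp [abs_of_pos hc]
  rw [h2, ← mul_assoc, ← ENNReal.ofReal_mul (by positivity),
    mul_inv_cancel₀ (by positivity), ENNReal.ofReal_one, one_mul]

theorem volume_annulus_smul {c : ℝ} (hc : 0 < c) (r : ℝ) :
    volume (annulus d (c * r)) = ENNReal.ofReal (c ^ d) * volume (annulus d r) := by
  simpa using setLIntegral_annulus_smul (d := d) (f := fun _ => 1) measurable_const hc r

theorem volume_annulus_lt_top (r : ℝ) : volume (annulus d r) < ⊤ :=
  (measure_mono (fun h hh => by simpa using hh.2)).trans_lt
    (measure_closedBall_lt_top (x := (0 : EuclideanSpace ℝ (Fin d))) (r := r))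

theorem volume_annulus_pos (hd : 0 < d) {r : ℝ} (hr : 0 < r) : 0 < volume (annulus d r) := by
  have : Nonempty (Fin d) := ⟨⟨0, hd⟩⟩
  -- The norm `3 r / 4` is the middle of `(r / 2, r]`, so a ball of radius `r / 4` around such a
  -- point fits.
  obtain ⟨v, hv⟩ := exists_norm_eq (EuclideanSpace ℝ (Fin d)) (show 0 ≤ 3 / 4 * r by positivity)
  have hsub : Metric.ball v (r / 4) ⊆ annulus d r := by
    intro h hh
    rw [mem_ball_iff_norm] at hh
    have h1 := norm_sub_norm_le h v
    have h2 := norm_sub_norm_le v h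
    rw [norm_sub_rev] at h2
    constructor <;> linarith
  exact (Metric.measure_ball_pos volume v (by positivity)).trans_le (measure_mono hsub)

theorem ofReal_two_rpow (p : ℝ) :
    ENNReal.ofReal (2 ^ p) = 2 * ENNReal.ofReal (2 ^ (p - 1)) := by
  rw [← ENNReal.ofReal_ofNat 2, ← ENNReal.ofReal_mul (by positivity),
    Real.rpow_sub_one (by norm_num)]
  congr 1
  field_simp

/-- The increment by `2h` is the sum of two increments by `h`, one of them translated; translation
invariance makes their energies equal. -/
theorem shiftEnergy_two_smul_le (hu : Measurable u) (hp : 1 ≤ p) (h : EuclideanSpace ℝ (Fin d)) :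
    shiftEnergy p u ((2 : ℝ) • h) ≤ ENNReal.ofReal (2 ^ p) * shiftEnergy p u h := by
  have hpt : ∀ x, ENNReal.ofReal (|u (x + (2 : ℝ) • h) - u x| ^ p) ≤
      ENNReal.ofReal (2 ^ (p - 1)) * (ENNReal.ofReal (|u (x + h + h) - u (x + h)| ^ p) +
        ENNReal.ofReal (|u (x + h) - u x| ^ p)) := by
    intro x
    rw [← ENNReal.ofReal_add (by positivity) (by positivity),
      ← ENNReal.ofReal_mul (by positivity)]
    apply ENNReal.ofReal_le_ofReal
    have := abs_add_rpow_le hp (u (x + h + h) - u (x + h)) (u (x + h) - u x)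
    rwa [sub_add_sub_cancel, add_assoc x h h, ← two_smul ℝ h] at *
  have hh : Measurable fun x => u (x + h) := hu.comp (measurable_add_const h)
  have hm : Measurable fun x => ENNReal.ofReal (|u (x + h) - u x| ^ p) := by fun_prop
  calc shiftEnergy p u ((2 : ℝ) • h)
      ≤ ∫⁻ x, ENNReal.ofReal (2 ^ (p - 1)) *
          (ENNReal.ofReal (|u (x + h + h) - u (x + h)| ^ p) +
          ENNReal.ofReal (|u (x + h) - u x| ^ p)) := lintegral_mono hpt
    _ = ENNReal.ofReal (2 ^ (p - 1)) * (shiftEnergy p u h + shiftEnergy p u h) := by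
      rw [lintegral_const_mul' _ _ ENNReal.ofReal_ne_top, lintegral_add_right _ hm,
        lintegral_add_right_eq_self (fun x => ENNReal.ofReal (|u (x + h) - u x| ^ p)) h,
        shiftEnergy]
    _ = ENNReal.ofReal (2 ^ p) * shiftEnergy p u h := by
      rw [ofReal_two_rpow p, ← two_mul, ← mul_assoc, mul_comm (2 : ℝ≥0∞)]

theorem annulusEnergy_two_mul_le (hu : Measurable u) (hp : 1 ≤ p) (r : ℝ) :
    annulusEnergy p u (2 * r) ≤
      ENNReal.ofReal (2 ^ d) * (ENNReal.ofReal (2 ^ p) * annulusEnergy p u r) := by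
  rw [annulusEnergy, setLIntegral_annulus_smul (measurable_shiftEnergy hu) two_pos]
  refine mul_le_mul_right ?_ _
  rw [annulusEnergy, ← lintegral_const_mul' _ _ ENNReal.ofReal_ne_top]
  exact lintegral_mono fun h => shiftEnergy_two_smul_le hu hp h

/-- Substitute `x = y + h` and exchange the order of integration. -/
theorem gagliardoEnergy_eq_lintegral_shiftEnergy (hu : Measurable u) (s : ℝ) :
    gagliardoEnergy s p u =
      ∫⁻ h, shiftEnergy p u h * ENNReal.ofReal (‖h‖ ^ (-((d : ℝ) + s * p))) := by
  have h1 : ∀ y : EuclideanSpace ℝ (Fin d),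
      ∫⁻ x, ENNReal.ofReal (|u x - u y| ^ p / ‖x - y‖ ^ ((d : ℝ) + s * p)) =
      ∫⁻ h, ENNReal.ofReal (|u (y + h) - u y| ^ p) *
        ENNReal.ofReal (‖h‖ ^ (-((d : ℝ) + s * p))) := by
    intro y
    rw [← lintegral_add_left_eq_self _ y]
    refine lintegral_congr fun h => ?_
    rw [← ENNReal.ofReal_mul (by positivity), add_sub_cancel_left, Real.rpow_neg (norm_nonneg _),
      div_eq_mul_inv]
  have hm := measurable_increment (p := p) hu
  have hn : Measurable fun h : EuclideanSpace ℝ (Fin d) =>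
      ENNReal.ofReal (‖h‖ ^ (-((d : ℝ) + s * p))) := by fun_prop
  rw [gagliardoEnergy, lintegral_congr h1, lintegral_lintegral_swap]
  · refine lintegral_congr fun h => ?_
    rw [lintegral_mul_const' _ _ ENNReal.ofReal_ne_top]
    rfl
  · exact ((hm.comp measurable_swap).mul (hn.comp measurable_snd)).aemeasurable

/-! ### Mass of high level sets -/

/-- At a point of the level set, integrate `|u x| ^ p ≤ 2 ^ (p - 1) * (|u (x + h) - u x| ^ p + |u (x
+ h)| ^ p)` over `h`. The last term contributes at most one, and the threshold is chosen so that the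
increment term dominates it. -/
theorem setLIntegral_level_le (hu : Measurable u) (hp : 1 ≤ p)
    (hone : ∫⁻ x, ENNReal.ofReal (|u x| ^ p) = 1) (r : ℝ) :
    volume (annulus d r) *
      ∫⁻ x in {x | ENNReal.ofReal (2 ^ p) < ENNReal.ofReal (|u x| ^ p) * volume (annulus d r)},
        ENNReal.ofReal (|u x| ^ p) ≤
      ENNReal.ofReal (2 ^ p) * annulusEnergy p u r := by
  set V := volume (annulus d r)
  have hVtop : V ≠ ⊤ := (volume_annulus_lt_top r).ne
  have hw : Measurable fun x => ENNReal.ofReal (|u x| ^ p) := by fun_prop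
  have hD := measurable_increment (p := p) hu
  have hkey : ∀ x, ENNReal.ofReal (2 ^ p) < ENNReal.ofReal (|u x| ^ p) * V →
      V * ENNReal.ofReal (|u x| ^ p) ≤ ENNReal.ofReal (2 ^ p) *
        ∫⁻ h in annulus d r, ENNReal.ofReal (|u (x + h) - u x| ^ p) := by
    intro x hx
    have hpt : ∀ h, ENNReal.ofReal (|u x| ^ p) ≤ ENNReal.ofReal (2 ^ (p - 1)) *
        (ENNReal.ofReal (|u (x + h) - u x| ^ p) + ENNReal.ofReal (|u (x + h)| ^ p)) := by
      intro h
      rw [← ENNReal.ofReal_add (by positivity) (by positivity),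
        ← ENNReal.ofReal_mul (by positivity)]
      apply ENNReal.ofReal_le_ofReal
      have := abs_add_rpow_le hp (u x - u (x + h)) (u (x + h))
      rwa [sub_add_cancel, abs_sub_comm] at this
    set J := ∫⁻ h in annulus d r, ENNReal.ofReal (|u (x + h) - u x| ^ p)
    have hint : V * ENNReal.ofReal (|u x| ^ p) ≤ ENNReal.ofReal (2 ^ (p - 1)) * (J + 1) := by
      calc V * ENNReal.ofReal (|u x| ^ p)
          = ∫⁻ _ in annulus d r, ENNReal.ofReal (|u x| ^ p) := by
            rw [setLIntegral_const, mul_comm]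
        _ ≤ ∫⁻ h in annulus d r, ENNReal.ofReal (2 ^ (p - 1)) *
            (ENNReal.ofReal (|u (x + h) - u x| ^ p) + ENNReal.ofReal (|u (x + h)| ^ p)) :=
            lintegral_mono hpt
        _ = ENNReal.ofReal (2 ^ (p - 1)) * (J +
            ∫⁻ h in annulus d r, ENNReal.ofReal (|u (x + h)| ^ p)) := by
            rw [lintegral_const_mul' _ _ ENNReal.ofReal_ne_top, lintegral_add_right]
            exact hw.comp (measurable_const_add x)
        _ ≤ ENNReal.ofReal (2 ^ (p - 1)) * (J + 1) := by
            gcongr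
            refine (setLIntegral_le_lintegral _ _).trans ?_
            rw [lintegral_add_left_eq_self (fun h => ENNReal.ofReal (|u h| ^ p)) x, hone]
    rw [mul_comm] at hx
    rw [ofReal_two_rpow] at hx ⊢
    -- Otherwise the bound `hint` would give at most `2 ^ p`, contradicting membership in the level
    -- set.
    have hJ1 : 1 ≤ J := by
      by_contra! hlt
      refine absurd (hx.trans_le hint) (not_lt.mpr ?_)
      rw [mul_comm 2]
      gcongr
      rw [← one_add_one_eq_two]
      gcongr
    refine hint.trans ?_
    rw [mul_comm 2, mul_assoc, two_mul]
    gcongr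
  rw [← lintegral_const_mul' _ _ hVtop]
  refine (setLIntegral_mono_ae' (measurableSet_lt measurable_const (hw.mul_const V))
    (ae_of_all _ hkey)).trans ((setLIntegral_le_lintegral _ _).trans ?_)
  rw [lintegral_const_mul' _ _ ENNReal.ofReal_ne_top]
  gcongr
  rw [lintegral_lintegral_swap]
  · rfl
  · exact (hD.comp measurable_swap).aemeasurable

/-! ### The gain of `1 - s` in dyadic sums -/

theorem tsum_ofReal_two_rpow_neg {t : ℝ} (ht : 0 < t) :
    ∑' k : ℕ, ENNReal.ofReal (2 ^ (-(k * t))) = ENNReal.ofReal ((1 - 2 ^ (-t))⁻¹) := by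
  have hlt : (2 : ℝ) ^ (-t) < 1 := Real.rpow_lt_one_of_one_lt_of_neg one_lt_two (by linarith)
  have hpow : ∀ k : ℕ, ENNReal.ofReal (2 ^ (-(k * t))) = ENNReal.ofReal (2 ^ (-t)) ^ k := by
    intro k
    rw [← ENNReal.ofReal_pow (by positivity), ← Real.rpow_natCast, ← Real.rpow_mul (by norm_num)]
    congr 2
    ring
  rw [tsum_congr hpow, ENNReal.tsum_geometric, ENNReal.ofReal_inv_of_pos (by linarith),
    ENNReal.ofReal_sub _ (by positivity), ENNReal.ofReal_one]

/-- A sequence which decays at most like `2 ^ (-p j)` has small sum compared to its sum with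
weights `2 ^ (s p j)`, with a gain of a factor `1 - s`. -/
theorem tsum_le_one_sub_mul_tsum {m : ℕ → ℝ≥0∞} (hp : 1 < p)
    (hm : ∀ j, m j ≤ ENNReal.ofReal (2 ^ p) * m (j + 1)) {s : ℝ} (hs0 : 0 < s) (hs1 : s < 1) :
    ∑' j, m j ≤ ENNReal.ofReal ((2 + p * Real.log 2 * (1 - 2 ^ (-(p / 2)))⁻¹) * (1 - s)) *
      ∑' j : ℕ, ENNReal.ofReal (2 ^ (j * (s * p))) * m j := by
  have hhalf : (2 : ℝ) ^ (-(p / 2)) < 1 :=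
    Real.rpow_lt_one_of_one_lt_of_neg one_lt_two (by linarith)
  have hinv : 0 < (1 - (2 : ℝ) ^ (-(p / 2)))⁻¹ := inv_pos.mpr (by linarith)
  have hlog : 0 < Real.log 2 := Real.log_pos one_lt_two
  set S := ∑' j : ℕ, ENNReal.ofReal (2 ^ (j * (s * p))) * m j
  -- For `s ≤ 1 / 2` there is nothing to gain: the weights are at least one and `2 * (1 - s) ≥ 1`.
  rcases le_total s (1 / 2) with hs | hs
  · have h1 : ∑' j, m j ≤ S := by
      refine ENNReal.tsum_le_tsum fun j => le_mul_of_one_le_left' ?_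
      rw [ENNReal.one_le_ofReal]
      exact Real.one_le_rpow (by norm_num) (by positivity)
    refine h1.trans (le_mul_of_one_le_left' ?_)
    rw [ENNReal.one_le_ofReal]
    have : 0 ≤ p * Real.log 2 * (1 - (2 : ℝ) ^ (-(p / 2)))⁻¹ := by positivity
    nlinarith
  · have hiter : ∀ j k : ℕ, ENNReal.ofReal (2 ^ (-(k * p))) * m j ≤ m (j + k) := by
      intro j k
      induction k with
      | zero => simp
      | succ k ih =>
        have h2 : ENNReal.ofReal (2 ^ (-(((k + 1 : ℕ) : ℝ) * p))) =
            ENNReal.ofReal (2 ^ (-p)) * ENNReal.ofReal (2 ^ (-(k * p))) := by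
          rw [← ENNReal.ofReal_mul (by positivity), ← Real.rpow_add two_pos]
          congr 2
          push_cast
          ring
        calc _ = ENNReal.ofReal (2 ^ (-p)) * (ENNReal.ofReal (2 ^ (-(k * p))) * m j) := by
              rw [h2, mul_assoc]
          _ ≤ ENNReal.ofReal (2 ^ (-p)) * (ENNReal.ofReal (2 ^ p) * m (j + k + 1)) := by
              exact mul_le_mul_right (ih.trans (hm _)) _
          _ = m (j + (k + 1)) := by
              rw [← mul_assoc, ← ENNReal.ofReal_mul (by positivity), ← Real.rpow_add two_pos,
                neg_add_cancel, Real.rpow_zero, ENNReal.ofReal_one, one_mul, add_assoc]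
    have ht : 0 < p * (1 - s) := mul_pos (by linarith) (by linarith)
    have hq : 0 < 1 - (2 : ℝ) ^ (-(p * (1 - s))) :=
      sub_pos.mpr (Real.rpow_lt_one_of_one_lt_of_neg one_lt_two (by linarith))
    have hq' : 1 - (2 : ℝ) ^ (-(p * (1 - s))) ≤ p * (1 - s) * Real.log 2 := by
      rw [Real.rpow_def_of_pos two_pos]
      have := Real.add_one_le_exp (Real.log 2 * -(p * (1 - s)))
      linarith
    -- The terms of `S` from index `j` on dominate `2 ^ (j s p) * m j` times a geometric series of
    -- ratio `2 ^ (-p (1 - s))`, whose sum is at least `1 / (p (1 - s) log 2)`.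
    have hj : ∀ j : ℕ, m j ≤
        ENNReal.ofReal (2 ^ (-(j * (s * p)))) * (ENNReal.ofReal (p * (1 - s) * Real.log 2) * S) := by
      intro j
      have h3 : ENNReal.ofReal (2 ^ (j * (s * p))) *
          ENNReal.ofReal ((1 - 2 ^ (-(p * (1 - s))))⁻¹) * m j ≤ S := by
        calc _ = ∑' k : ℕ, ENNReal.ofReal (2 ^ (j * (s * p))) *
              ENNReal.ofReal (2 ^ (-(k * (p * (1 - s))))) * m j := by
              rw [ENNReal.tsum_mul_right, ENNReal.tsum_mul_left, tsum_ofReal_two_rpow_neg ht]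
          _ = ∑' k : ℕ, ENNReal.ofReal (2 ^ (((j + k : ℕ) : ℝ) * (s * p))) *
              (ENNReal.ofReal (2 ^ (-(k * p))) * m j) := by
              refine tsum_congr fun k => ?_
              rw [← mul_assoc (ENNReal.ofReal (2 ^ (((j + k : ℕ) : ℝ) * (s * p)))),
                ← ENNReal.ofReal_mul (by positivity),
                ← ENNReal.ofReal_mul (by positivity), ← Real.rpow_add two_pos,
                ← Real.rpow_add two_pos]
              congr 3
              push_cast
              ring
          _ ≤ ∑' k : ℕ, ENNReal.ofReal (2 ^ (((j + k : ℕ) : ℝ) * (s * p))) * m (j + k) := by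
              gcongr with k
              exact hiter j k
          _ ≤ S := ENNReal.tsum_comp_le_tsum_of_injective (add_right_injective j)
              fun i : ℕ => ENNReal.ofReal (2 ^ ((i : ℝ) * (s * p))) * m i
      calc m j = ENNReal.ofReal (2 ^ (-(j * (s * p)))) *
            (ENNReal.ofReal (1 - 2 ^ (-(p * (1 - s)))) * (ENNReal.ofReal (2 ^ (j * (s * p))) *
            ENNReal.ofReal ((1 - 2 ^ (-(p * (1 - s))))⁻¹) * m j)) := by
            have assoc : ∀ a b c e x : ℝ≥0∞, a * (b * (c * e * x)) = a * b * c * e * x := by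
              intros; ring
            rw [assoc, ← ENNReal.ofReal_mul (by positivity), ← ENNReal.ofReal_mul (by positivity),
              ← ENNReal.ofReal_mul (by positivity)]
            have : (2 : ℝ) ^ (-(j * (s * p))) * (1 - 2 ^ (-(p * (1 - s)))) * 2 ^ (j * (s * p)) *
                (1 - 2 ^ (-(p * (1 - s))))⁻¹ = 1 := by
              rw [Real.rpow_neg (by norm_num) ((j : ℝ) * (s * p))]
              field_simp
            rw [this, ENNReal.ofReal_one, one_mul]
        _ ≤ _ := by gcongr
    calc ∑' j, m j ≤ ∑' j : ℕ, ENNReal.ofReal (2 ^ (-(j * (s * p)))) *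
          (ENNReal.ofReal (p * (1 - s) * Real.log 2) * S) := ENNReal.tsum_le_tsum hj
      _ = ENNReal.ofReal ((1 - 2 ^ (-(s * p)))⁻¹ * (p * (1 - s) * Real.log 2)) * S := by
          rw [ENNReal.tsum_mul_right, tsum_ofReal_two_rpow_neg (by positivity), ← mul_assoc,
            ← ENNReal.ofReal_mul]
          exact (inv_pos.mpr (sub_pos.mpr (Real.rpow_lt_one_of_one_lt_of_neg one_lt_two
            (neg_lt_zero.mpr (by positivity))))).le
      _ ≤ _ := by
          refine mul_le_mul_left (ENNReal.ofReal_le_ofReal ?_) S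
          have h4 : (1 - (2 : ℝ) ^ (-(s * p)))⁻¹ ≤ (1 - (2 : ℝ) ^ (-(p / 2)))⁻¹ := by
            apply inv_anti₀ (by linarith)
            have : (2 : ℝ) ^ (-(s * p)) ≤ 2 ^ (-(p / 2)) :=
              Real.rpow_le_rpow_of_exponent_le (by norm_num) (by nlinarith)
            linarith
          have h5 : 0 ≤ p * (1 - s) * Real.log 2 := by positivity
          have := mul_le_mul_of_nonneg_right h4 h5
          nlinarith

/-! ### Dyadic decomposition and the entropy estimate -/

theorem disjoint_annulus (r : ℝ) (hr : 0 < r) :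
    Pairwise (Function.onFun Disjoint fun j : ℕ => annulus d (r / 2 ^ j)) := by
  have aux : ∀ i j : ℕ, i < j → Disjoint (annulus d (r / 2 ^ i)) (annulus d (r / 2 ^ j)) := by
    intro i j hij
    rw [Set.disjoint_left]
    intro h h1 h2
    have h3 := h1.1.trans_le h2.2
    rw [div_div, ← pow_succ] at h3
    exact absurd h3 (not_lt.mpr (by gcongr <;> [norm_num; omega]))
  intro i j hij
  rcases lt_or_gt_of_ne hij with h | h
  · exact aux i j h
  · exact (aux j i h).symm

/-- The annuli of radii `r / 2 ^ j` are disjoint, and on each of them the kernel is at least its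
value at the outer radius. -/
theorem tsum_annulusEnergy_le (hu : Measurable u) {s r : ℝ} (hr : 0 < r) (hs : 0 < s)
    (hp : 1 < p) :
    ENNReal.ofReal (r ^ (-((d : ℝ) + s * p))) * ∑' j : ℕ, ENNReal.ofReal (2 ^ (j * (s * p))) *
      (ENNReal.ofReal ((2 ^ j) ^ d) * annulusEnergy p u (r / 2 ^ j)) ≤ gagliardoEnergy s p u := by
  rw [gagliardoEnergy_eq_lintegral_shiftEnergy hu, ← ENNReal.tsum_mul_left]
  refine le_trans ?_ (setLIntegral_le_lintegral (⋃ j : ℕ, annulus d (r / 2 ^ j)) _)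
  rw [lintegral_iUnion (fun j => measurableSet_annulus _) (disjoint_annulus r hr)]
  refine ENNReal.tsum_le_tsum fun j => ?_
  have hc : r ^ (-((d : ℝ) + s * p)) * (2 ^ (j * (s * p)) * (2 ^ j) ^ d) =
      (r / 2 ^ j) ^ (-((d : ℝ) + s * p)) := by
    rw [Real.div_rpow hr.le (by positivity), ← Real.rpow_natCast 2 j, ← Real.rpow_mul two_pos.le,
      ← Real.rpow_mul_natCast two_pos.le, ← Real.rpow_add two_pos, div_eq_mul_inv,
      ← Real.rpow_neg two_pos.le]
    congr 2
    ring
  rw [← mul_assoc (ENNReal.ofReal (2 ^ _)), ← ENNReal.ofReal_mul (by positivity), ← mul_assoc,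
    ← ENNReal.ofReal_mul (by positivity), hc, annulusEnergy,
    ← lintegral_const_mul' _ _ ENNReal.ofReal_ne_top]
  refine setLIntegral_mono_ae' (measurableSet_annulus _) (ae_of_all _ fun h hh => ?_)
  rw [mul_comm]
  gcongr 2
  have h0 : 0 < ‖h‖ := lt_trans (by positivity) hh.1
  exact Real.rpow_le_rpow_of_nonpos h0 hh.2 (by
    have : (0 : ℝ) ≤ d := Nat.cast_nonneg d
    nlinarith [mul_pos hs (zero_lt_one.trans hp)])

/-- A discrete layer-cake bound: the number of `j` with `T * 2 ^ (j d) < v` is at least `log (v / T)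
/ (d log 2)`. -/
theorem ofReal_mul_log_div_le (hd : 0 < d) {v T : ℝ} (hv : 0 ≤ v) (hT : 0 < T) :
    ENNReal.ofReal (v * Real.log (v / T)) ≤ ENNReal.ofReal (d * Real.log 2) *
      ∑' j : ℕ, if T * (2 ^ j) ^ d < v then ENNReal.ofReal v else 0 := by
  have hlog : 0 < Real.log 2 := Real.log_pos one_lt_two
  have hL : 0 < (d : ℝ) * Real.log 2 := by positivity
  rcases le_or_gt v T with h | h
  · rw [ENNReal.ofReal_of_nonpos]
    · exact zero_le
    · exact mul_nonpos_of_nonneg_of_nonpos hv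
        (Real.log_nonpos (by positivity) ((div_le_one hT).mpr h))
  · have hv0 : 0 < v := hT.trans h
    set n := ⌈Real.log (v / T) / (d * Real.log 2)⌉₊ with hn
    have hsum : (n : ℝ≥0∞) * ENNReal.ofReal v ≤
        ∑' j : ℕ, if T * (2 ^ j) ^ d < v then ENNReal.ofReal v else 0 := by
      refine le_trans (le_of_eq ?_) (ENNReal.sum_le_tsum (Finset.range n))
      rw [Finset.sum_congr rfl (g := fun _ => ENNReal.ofReal v)]
      · simp
      · intro j hj
        rw [Finset.mem_range, hn, Nat.lt_ceil, lt_div_iff₀ hL] at hj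
        rw [if_pos]
        rw [mul_comm, ← lt_div_iff₀ hT, ← Real.log_lt_log_iff (by positivity) (by positivity),
          Real.log_pow, Real.log_pow]
        linarith
    refine le_trans ?_ (mul_le_mul_right hsum _)
    rw [← ENNReal.ofReal_natCast, ← ENNReal.ofReal_mul (by positivity),
      ← ENNReal.ofReal_mul (by positivity)]
    apply ENNReal.ofReal_le_ofReal
    have := Nat.le_ceil (Real.log (v / T) / (d * Real.log 2))
    rw [div_le_iff₀ hL] at this
    nlinarith

/-- The entropy estimate at scale `r`. -/
theorem exists_lintegral_mul_log_le (hd : 0 < d) (hp : 1 < p) :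
    ∃ c C : ℝ, 0 < c ∧ 0 < C ∧ ∀ s : ℝ, 0 < s → s < 1 →
      ∀ u : EuclideanSpace ℝ (Fin d) → ℝ, Measurable u →
        ∫⁻ x, ENNReal.ofReal (|u x| ^ p) = 1 → ∀ r : ℝ, 0 < r →
          ∫⁻ x, ENNReal.ofReal (|u x| ^ p * Real.log (|u x| ^ p / (c / r ^ d))) ≤
            ENNReal.ofReal (C * (1 - s) * r ^ (s * p)) * gagliardoEnergy s p u := by
  set v := (volume (annulus d 1)).toReal with hv
  have hvpos : 0 < v :=
    ENNReal.toReal_pos (volume_annulus_pos hd one_pos).ne' (volume_annulus_lt_top 1).ne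
  have hlog : 0 < Real.log 2 := Real.log_pos one_lt_two
  set B := 2 + p * Real.log 2 * (1 - 2 ^ (-(p / 2)))⁻¹
  have hBpos : 0 < B := by
    have hhalf : (2 : ℝ) ^ (-(p / 2)) < 1 :=
      Real.rpow_lt_one_of_one_lt_of_neg one_lt_two (by linarith)
    have hinv : 0 < (1 - (2 : ℝ) ^ (-(p / 2)))⁻¹ := inv_pos.mpr (by linarith)
    positivity
  -- With `c = 2 ^ p / v`, the quantity `c / r ^ d` is `2 ^ p` divided by the volume of the annulus
  -- of radius `r`.
  refine ⟨2 ^ p / v, d * Real.log 2 * v⁻¹ * 2 ^ p * B, by positivity, by positivity, ?_⟩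
  intro s hs0 hs1 u hu hone r hr
  have hV : ∀ j : ℕ, volume (annulus d (r / 2 ^ j)) = ENNReal.ofReal (v * r ^ d / (2 ^ j) ^ d) := by
    intro j
    rw [show r / 2 ^ j = r / 2 ^ j * 1 by ring, volume_annulus_smul (by positivity),
      ← ENNReal.ofReal_toReal (volume_annulus_lt_top (d := d) 1).ne,
      ← ENNReal.ofReal_mul (by positivity), ← hv, div_pow]
    congr 1
    ring
  set T := 2 ^ p / v / r ^ d with hT
  have hTpos : 0 < T := by positivity
  -- The factor `2 ^ (j d)` compensates the shrinking volume of the annuli, so that passing from `j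
  -- + 1` to `j` costs only `2 ^ p`.
  set m : ℕ → ℝ≥0∞ := fun j => ENNReal.ofReal ((2 ^ j) ^ d) * annulusEnergy p u (r / 2 ^ j) with hm
  have hmstep : ∀ j, m j ≤ ENNReal.ofReal (2 ^ p) * m (j + 1) := by
    intro j
    have h1 := annulusEnergy_two_mul_le hu hp.le (r / 2 ^ (j + 1))
    rw [show 2 * (r / 2 ^ (j + 1)) = r / 2 ^ j by rw [pow_succ]; field_simp] at h1
    refine (mul_le_mul_right h1 _).trans (le_of_eq ?_)
    simp only [hm]
    rw [← mul_assoc, ← ENNReal.ofReal_mul (by positivity), ← mul_pow, ← pow_succ,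
      mul_left_comm]
  have hS := tsum_le_one_sub_mul_tsum hp hmstep hs0 hs1
  have hE := tsum_annulusEnergy_le hu hr hs0 hp
  have hlevel : ∀ j : ℕ, ∫⁻ x in {x | T * (2 ^ j) ^ d < |u x| ^ p}, ENNReal.ofReal (|u x| ^ p) ≤
      ENNReal.ofReal ((v * r ^ d)⁻¹ * 2 ^ p) * m j := by
    intro j
    have h1 := setLIntegral_level_le hu hp.le hone (r / 2 ^ j)
    have hset : {x | ENNReal.ofReal (2 ^ p) <
        ENNReal.ofReal (|u x| ^ p) * volume (annulus d (r / 2 ^ j))} =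
        {x | T * (2 ^ j) ^ d < |u x| ^ p} := by
      ext x
      simp only [Set.mem_ofPred_eq]
      rw [hV, ← ENNReal.ofReal_mul (by positivity), ENNReal.ofReal_lt_ofReal_iff_of_nonneg
        (by positivity), ← div_lt_iff₀ (by positivity)]
      rw [show (2 : ℝ) ^ p / (v * r ^ d / (2 ^ j) ^ d) = T * (2 ^ j) ^ d by
        rw [hT]; field_simp]
    rw [hset, hV] at h1
    set I := ∫⁻ x in {x | T * (2 ^ j) ^ d < |u x| ^ p}, ENNReal.ofReal (|u x| ^ p)
    calc I = ENNReal.ofReal ((v * r ^ d)⁻¹ * (2 ^ j) ^ d) *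
          (ENNReal.ofReal (v * r ^ d / (2 ^ j) ^ d) * I) := by
          rw [← mul_assoc, ← ENNReal.ofReal_mul (by positivity)]
          rw [show (v * r ^ d)⁻¹ * (2 ^ j) ^ d * (v * r ^ d / (2 ^ j) ^ d) = 1 by field_simp,
            ENNReal.ofReal_one, one_mul]
      _ ≤ ENNReal.ofReal ((v * r ^ d)⁻¹ * (2 ^ j) ^ d) *
          (ENNReal.ofReal (2 ^ p) * annulusEnergy p u (r / 2 ^ j)) := by gcongr
      _ = _ := by
          simp only [hm]
          rw [← mul_assoc, ← mul_assoc, ← ENNReal.ofReal_mul (by positivity),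
            ← ENNReal.ofReal_mul (by positivity)]
          congr 2
          ring
  have hw : Measurable fun x => |u x| ^ p := by fun_prop
  calc ∫⁻ x, ENNReal.ofReal (|u x| ^ p * Real.log (|u x| ^ p / T))
      ≤ ∫⁻ x, ENNReal.ofReal (d * Real.log 2) *
        ∑' j : ℕ, if T * (2 ^ j) ^ d < |u x| ^ p then ENNReal.ofReal (|u x| ^ p) else 0 :=
        lintegral_mono fun x => ofReal_mul_log_div_le hd (by positivity) hTpos
    _ = ENNReal.ofReal (d * Real.log 2) * ∑' j : ℕ,
        ∫⁻ x in {x | T * (2 ^ j) ^ d < |u x| ^ p}, ENNReal.ofReal (|u x| ^ p) := by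
        rw [lintegral_const_mul' _ _ ENNReal.ofReal_ne_top, lintegral_tsum]
        · congr 1
          refine tsum_congr fun j => ?_
          rw [← lintegral_indicator (measurableSet_lt measurable_const hw)]
          rfl
        · intro j
          exact (Measurable.ite (measurableSet_lt measurable_const hw) hw.ennreal_ofReal
            measurable_const).aemeasurable
    _ ≤ ENNReal.ofReal (d * Real.log 2) * ∑' j : ℕ, ENNReal.ofReal ((v * r ^ d)⁻¹ * 2 ^ p) * m j := by
        gcongr with j
        exact hlevel j
    _ ≤ ENNReal.ofReal (d * Real.log 2) * (ENNReal.ofReal ((v * r ^ d)⁻¹ * 2 ^ p) *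
        (ENNReal.ofReal (B * (1 - s)) * (ENNReal.ofReal (r ^ ((d : ℝ) + s * p)) *
        (ENNReal.ofReal (r ^ (-((d : ℝ) + s * p))) *
        ∑' j : ℕ, ENNReal.ofReal (2 ^ (j * (s * p))) * m j)))) := by
        rw [ENNReal.tsum_mul_left]
        gcongr
        rwa [← mul_assoc (ENNReal.ofReal (r ^ _)), ← ENNReal.ofReal_mul (by positivity),
          ← Real.rpow_add hr, add_neg_cancel, Real.rpow_zero, ENNReal.ofReal_one, one_mul]
    _ ≤ ENNReal.ofReal (d * Real.log 2) * (ENNReal.ofReal ((v * r ^ d)⁻¹ * 2 ^ p) *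
        (ENNReal.ofReal (B * (1 - s)) * (ENNReal.ofReal (r ^ ((d : ℝ) + s * p)) *
        gagliardoEnergy s p u))) := by gcongr
    _ = _ := by
        have hs' : 0 < 1 - s := by linarith
        rw [← mul_assoc, ← mul_assoc, ← mul_assoc, ← ENNReal.ofReal_mul (by positivity),
          ← ENNReal.ofReal_mul (by positivity), ← ENNReal.ofReal_mul (by positivity)]
        congr 2
        rw [Real.rpow_add hr, Real.rpow_natCast]
        field_simp

/-! ### Finiteness of the energy -/

theorem gagliardoEnergy_congr_ae {v : EuclideanSpace ℝ (Fin d) → ℝ} (s : ℝ) (h : u =ᵐ[volume] v) :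
    gagliardoEnergy s p u = gagliardoEnergy s p v := by
  refine lintegral_congr_ae ?_
  filter_upwards [h] with y hy
  refine lintegral_congr_ae ?_
  filter_upwards [h] with x hx
  rw [hx, hy]

/-- Measurability of one summand is enough to split the integrals, so `v` may be the difference of a
Sobolev function and its approximant. -/
theorem gagliardoEnergy_add_le (hp : 1 ≤ p) (s : ℝ) (v : EuclideanSpace ℝ (Fin d) → ℝ)
    {φ : EuclideanSpace ℝ (Fin d) → ℝ} (hφ : Measurable φ) :
    gagliardoEnergy s p (fun x => v x + φ x) ≤
      ENNReal.ofReal (2 ^ (p - 1)) * (gagliardoEnergy s p v + gagliardoEnergy s p φ) := by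
  have hm : Measurable fun z : EuclideanSpace ℝ (Fin d) × EuclideanSpace ℝ (Fin d) =>
      ENNReal.ofReal (|φ z.2 - φ z.1| ^ p / ‖z.2 - z.1‖ ^ ((d : ℝ) + s * p)) := by
    have h1 : Measurable fun z : EuclideanSpace ℝ (Fin d) × EuclideanSpace ℝ (Fin d) => φ z.1 :=
      hφ.comp measurable_fst
    have h2 : Measurable fun z : EuclideanSpace ℝ (Fin d) × EuclideanSpace ℝ (Fin d) => φ z.2 :=
      hφ.comp measurable_snd
    fun_prop
  have hmy : ∀ y, Measurable fun x =>
      ENNReal.ofReal (|φ x - φ y| ^ p / ‖x - y‖ ^ ((d : ℝ) + s * p)) := fun y => by fun_prop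
  have hout : Measurable fun y => ∫⁻ x,
      ENNReal.ofReal (|φ x - φ y| ^ p / ‖x - y‖ ^ ((d : ℝ) + s * p)) := hm.lintegral_prod_right'
  unfold gagliardoEnergy
  rw [← lintegral_add_right _ hout, ← lintegral_const_mul' _ _ ENNReal.ofReal_ne_top]
  refine lintegral_mono fun y => ?_
  rw [← lintegral_add_right _ (hmy y), ← lintegral_const_mul' _ _ ENNReal.ofReal_ne_top]
  refine lintegral_mono fun x => ?_
  dsimp only
  rw [← ENNReal.ofReal_add (by positivity) (by positivity), ← ENNReal.ofReal_mul (by positivity),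
    ← add_div, ← mul_div_assoc]
  refine ENNReal.ofReal_le_ofReal (div_le_div_of_nonneg_right ?_ (by positivity))
  have := abs_add_rpow_le hp (v x - v y) (φ x - φ y)
  rwa [sub_add_sub_comm] at this

theorem exists_shiftEnergy_le {φ : EuclideanSpace ℝ (Fin d) → ℝ} (hp : 1 < p)
    (hφ : ContDiff ℝ ∞ φ) (hc : HasCompactSupport φ) :
    ∃ A : ℝ, 0 ≤ A ∧ ∀ h, shiftEnergy p φ h ≤ ENNReal.ofReal (A * min ‖h‖ 1 ^ p) := by
  obtain ⟨L, hL⟩ := hφ.lipschitzWith_of_hasCompactSupport hc (by simp)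
  obtain ⟨B, hB⟩ := hc.exists_bound_of_continuous hφ.continuous
  have hB0 : 0 ≤ B := (norm_nonneg _).trans (hB 0)
  set D : ℝ := max L (2 * B) with hD
  have hD0 : 0 ≤ D := le_max_of_le_left L.2
  have hbound : ∀ x h, |φ (x + h) - φ x| ≤ D * min ‖h‖ 1 := by
    intro x h
    rw [mul_min_of_nonneg _ _ hD0, le_min_iff]
    constructor
    · have := hL.dist_le_mul (x + h) x
      rw [Real.dist_eq, dist_self_add_left] at this
      exact this.trans (by gcongr; exact le_max_left _ _)
    · have h1 := hB (x + h)
      have h2 := hB x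
      rw [Real.norm_eq_abs] at h1 h2
      have h3 := abs_sub (φ (x + h)) (φ x)
      have h4 : 2 * B ≤ D := le_max_right _ _
      linarith
  set S := tsupport φ
  have hSm : MeasurableSet S := (isClosed_tsupport φ).measurableSet
  have hStop : volume S ≠ ⊤ := hc.isCompact.measure_lt_top.ne
  refine ⟨2 * (volume S).toReal * D ^ p, by positivity, fun h => ?_⟩
  -- The increment vanishes unless `x` or `x + h` lies in the support, a set of finite volume.
  have hpt : ∀ x, ENNReal.ofReal (|φ (x + h) - φ x| ^ p) ≤
      ENNReal.ofReal ((D * min ‖h‖ 1) ^ p) * (S.indicator 1 (x + h) + S.indicator 1 x) := by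
    intro x
    by_cases hx : x + h ∈ S ∨ x ∈ S
    · refine (ENNReal.ofReal_le_ofReal (Real.rpow_le_rpow (abs_nonneg _) (hbound x h)
        (by linarith))).trans (le_mul_of_one_le_right' ?_)
      rcases hx with hx | hx
      · simp [hx]
      · simp [hx]
    · push Not at hx
      rw [image_eq_zero_of_notMem_tsupport hx.1, image_eq_zero_of_notMem_tsupport hx.2]
      simp [Real.zero_rpow (by linarith : p ≠ 0)]
  calc shiftEnergy p φ h ≤ _ := lintegral_mono hpt
    _ = ENNReal.ofReal ((D * min ‖h‖ 1) ^ p) * (volume S + volume S) := by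
      rw [lintegral_const_mul' _ _ ENNReal.ofReal_ne_top,
        lintegral_add_right _ (measurable_one.indicator hSm),
        lintegral_add_right_eq_self (fun x => S.indicator (1 : EuclideanSpace ℝ (Fin d) → ℝ≥0∞) x) h,
        lintegral_indicator_one hSm]
    _ = _ := by
      rw [← ENNReal.ofReal_toReal hStop, ← ENNReal.ofReal_add (by positivity) (by positivity),
        ← ENNReal.ofReal_mul (by positivity), Real.mul_rpow hD0 (by positivity),
        ENNReal.toReal_ofReal (by positivity)]
      congr 1
      ring

theorem gagliardoEnergy_lt_top_of_contDiff (hd : 0 < d) {φ : EuclideanSpace ℝ (Fin d) → ℝ}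
    (hp : 1 < p) {s : ℝ} (hs0 : 0 < s) (hs1 : s < 1)
    (hφ : ContDiff ℝ ∞ φ) (hc : HasCompactSupport φ) : gagliardoEnergy s p φ < ⊤ := by
  obtain ⟨A, hA0, hA⟩ := exists_shiftEnergy_le hp hφ hc
  have hsp : 0 < s * p := by positivity
  have hd0 : (0 : ℝ) < d := by exact_mod_cast hd
  rw [gagliardoEnergy_eq_lintegral_shiftEnergy hφ.continuous.measurable]
  refine (lintegral_mono fun h => mul_le_mul_left (hA h) _).trans_lt ?_
  -- Inside the unit ball the integrand is at most `A * ‖h‖ ^ (p - d - s p)`, integrable since `s <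
  -- 1`; outside, it decays like `‖h‖ ^ (-(d + s p))`, integrable since `s p > 0`.
  rw [← lintegral_add_compl _ (measurableSet_ball (x := (0 : EuclideanSpace ℝ (Fin d))) (ε := 1)),
    ENNReal.add_lt_top]
  constructor
  · have hint : IntegrableOn (fun h : EuclideanSpace ℝ (Fin d) =>
        A * min ‖h‖ 1 ^ p * ‖h‖ ^ (-((d : ℝ) + s * p))) (Metric.ball 0 1) := by
      refine integrableOn_ball_of_norm_le_rpow (C := A) (α := d + s * p - p) (by simpa) ?_ ?_ ?_
      · rw [finrank_euclideanSpace_fin]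
        nlinarith
      · refine ae_restrict_of_ae_restrict_of_subset (Set.subset_univ _) (ae_of_all _ fun h => ?_)
        rw [Real.norm_of_nonneg (by positivity), mul_assoc]
        refine mul_le_mul_of_nonneg_left ?_ hA0
        rcases eq_or_lt_of_le (norm_nonneg h) with h0 | h0
        · rw [← h0, min_eq_left zero_le_one, Real.zero_rpow (by linarith), zero_mul]
          positivity
        · calc _ ≤ ‖h‖ ^ p * ‖h‖ ^ (-((d : ℝ) + s * p)) := by
                gcongr
                exact min_le_left _ _
            _ = _ := by
                rw [← Real.rpow_add h0]
                congr 1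
                ring
      · exact Measurable.aestronglyMeasurable (by fun_prop)
    refine lt_of_eq_of_lt ?_ hint.lintegral_lt_top
    refine lintegral_congr fun h => ?_
    rw [← ENNReal.ofReal_mul (by positivity)]
  · have hfin := finite_integral_one_add_norm
      (μ := (volume : Measure (EuclideanSpace ℝ (Fin d)))) (r := d + s * p)
      (by rw [finrank_euclideanSpace_fin]; linarith)
    -- The factor `2 ^ (d + s p)` comes from `1 + ‖h‖ ≤ 2 * ‖h‖` for `‖h‖ ≥ 1`.
    refine lt_of_le_of_lt ?_ (ENNReal.mul_lt_top
      (ENNReal.ofReal_lt_top (r := A * 2 ^ ((d : ℝ) + s * p))) hfin)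
    rw [← lintegral_const_mul' _ _ ENNReal.ofReal_ne_top]
    refine (setLIntegral_mono_ae' measurableSet_ball.compl (ae_of_all _ fun h hh => ?_)).trans
      (setLIntegral_le_lintegral _ _)
    have h1 : 1 ≤ ‖h‖ := by simpa using hh
    rw [← ENNReal.ofReal_mul (by positivity), ← ENNReal.ofReal_mul (by positivity),
      min_eq_right h1, Real.one_rpow, mul_one, mul_assoc]
    refine ENNReal.ofReal_le_ofReal (mul_le_mul_of_nonneg_left ?_ hA0)
    rw [Real.rpow_neg (by positivity), Real.rpow_neg (by positivity), ← div_eq_mul_inv,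
      ← Real.inv_rpow (by positivity), ← Real.div_rpow (by positivity) (by positivity)]
    refine Real.rpow_le_rpow (by positivity) ?_ (by positivity)
    rw [inv_eq_one_div, div_le_div_iff₀ (by positivity) (by positivity)]
    linarith

theorem MemFracSobolev.gagliardoEnergy_lt_top (hd : 0 < d) (hp : 1 < p) {s : ℝ} (hs0 : 0 < s)
    (hs1 : s < 1) (hu : MemFracSobolev s p u) : gagliardoEnergy s p u < ⊤ := by
  obtain ⟨-, φ, hφ, hlim⟩ := hu
  -- One approximant at finite distance suffices.
  obtain ⟨n, hn⟩ := (hlim.eventually_lt_const ENNReal.zero_lt_top).exists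
  have h1 : gagliardoEnergy s p (fun x => u x - φ n x) < ⊤ := by
    refine lt_of_le_of_lt le_add_self ((ENNReal.rpow_lt_top_iff_of_pos ?_).mp hn)
    positivity
  have h2 := gagliardoEnergy_lt_top_of_contDiff hd hp hs0 hs1 (hφ n).1 (hφ n).2
  have h3 := gagliardoEnergy_add_le hp.le s (fun x => u x - φ n x) (hφ n).1.continuous.measurable
  simp only [sub_add_cancel] at h3
  exact h3.trans_lt (ENNReal.mul_lt_top ENNReal.ofReal_lt_top (ENNReal.add_lt_top.mpr ⟨h1, h2⟩))

/-! ### Extended integrals and the choice of scale -/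

theorem extIntegral_le_of_eq_add {f g w : EuclideanSpace ℝ (Fin d) → ℝ} {a K : ℝ} (hK : 0 ≤ K)
    (hw0 : ∀ x, 0 ≤ w x) (hw : Measurable w) (hg : Measurable g)
    (hf : ∀ x, f x = a * w x + g x) (hone : ∫⁻ x, ENNReal.ofReal (w x) = 1)
    (hgK : ∫⁻ x, ENNReal.ofReal (g x) ≤ ENNReal.ofReal K) :
    ∫⁻ x, ENNReal.ofReal (f x) < ⊤ ∧ extIntegral f ≤ ((a + K : ℝ) : EReal) := by
  have hfm : Measurable f := by
    rw [funext hf]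
    fun_prop
  have hfn : Measurable fun x => ENNReal.ofReal (-f x) := hfm.neg.ennreal_ofReal
  have hint : ∀ b : ℝ, ∫⁻ x, ENNReal.ofReal b * ENNReal.ofReal (w x) = ENNReal.ofReal b := by
    intro b
    rw [lintegral_const_mul' _ _ ENNReal.ofReal_ne_top, hone, mul_one]
  have hlt : ∫⁻ x, ENNReal.ofReal (f x) < ⊤ := by
    calc ∫⁻ x, ENNReal.ofReal (f x)
        ≤ ∫⁻ x, (ENNReal.ofReal a * ENNReal.ofReal (w x) + ENNReal.ofReal (g x)) := by
          refine lintegral_mono fun x => ?_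
          rw [hf, ← ENNReal.ofReal_mul' (hw0 x)]
          exact ENNReal.ofReal_add_le
      _ ≤ ENNReal.ofReal a + ENNReal.ofReal K := by
          rw [lintegral_add_right _ hg.ennreal_ofReal, hint]
          gcongr
      _ < ⊤ := ENNReal.add_lt_top.mpr ⟨ENNReal.ofReal_lt_top, ENNReal.ofReal_lt_top⟩
  refine ⟨hlt, ?_⟩
  -- All negative parts are moved across, which avoids subtraction in `ℝ≥0∞` and allows the integral
  -- of the negative part of `f` to be infinite.
  have hsum : (∫⁻ x, ENNReal.ofReal (f x)) + ENNReal.ofReal (-a) ≤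
      (∫⁻ x, ENNReal.ofReal (-f x)) + (ENNReal.ofReal a + ENNReal.ofReal K) := by
    calc _ = ∫⁻ x, (ENNReal.ofReal (f x) + ENNReal.ofReal (-a) * ENNReal.ofReal (w x)) := by
          rw [lintegral_add_left hfm.ennreal_ofReal, hint]
      _ ≤ ∫⁻ x, (ENNReal.ofReal (-f x) +
          (ENNReal.ofReal a * ENNReal.ofReal (w x) + ENNReal.ofReal (g x))) := by
          refine lintegral_mono fun x => ?_
          rw [← ENNReal.ofReal_mul' (hw0 x), ← ENNReal.ofReal_mul' (hw0 x)]
          simp only [ENNReal.ofReal]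
          norm_cast
          rw [← NNReal.coe_le_coe]
          simp only [NNReal.coe_add, Real.coe_toNNReal']
          have h1 := hf x
          have h2 := max_zero_sub_max_neg_zero_eq_self (f x)
          have h3 := max_zero_sub_max_neg_zero_eq_self (a * w x)
          have h4 := le_max_left (g x) 0
          rw [← neg_mul] at h3
          linarith
      _ ≤ _ := by
          rw [lintegral_add_left hfn, lintegral_add_right _ hg.ennreal_ofReal,
            hint]
          gcongr
  unfold extIntegral
  by_cases htop : ∫⁻ x, ENNReal.ofReal (-f x) = ⊤
  · rw [htop, EReal.coe_ennreal_top, EReal.sub_top]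
    exact bot_le
  · rw [← EReal.coe_ennreal_toReal hlt.ne, ← EReal.coe_ennreal_toReal htop, ← EReal.coe_sub,
      EReal.coe_le_coe_iff]
    have h5 := ENNReal.toReal_mono (by finiteness) hsum
    rw [ENNReal.toReal_add hlt.ne ENNReal.ofReal_ne_top, ENNReal.toReal_add htop (by finiteness),
      ENNReal.toReal_add ENNReal.ofReal_ne_top ENNReal.ofReal_ne_top, ENNReal.toReal_ofReal hK,
      ENNReal.toReal_ofReal', ENNReal.toReal_ofReal'] at h5
    have h6 := max_zero_sub_max_neg_zero_eq_self a
    linarith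

theorem rpow_mul_log_eq (hp : 1 < p) {t T : ℝ} (hT : 0 < T) :
    |t| ^ p * Real.log |t| =
      Real.log T / p * |t| ^ p + p⁻¹ * (|t| ^ p * Real.log (|t| ^ p / T)) := by
  rcases eq_or_ne t 0 with rfl | ht
  · simp [Real.zero_rpow (by linarith : p ≠ 0)]
  · have h0 : 0 < |t| := abs_pos.mpr ht
    rw [Real.log_div (by positivity) hT.ne', Real.log_rpow h0]
    field_simp
    ring

/-- Vanishing at scale `r` forces `|u| ^ p ≤ c / r ^ d` almost everywhere; let `r` tend to infinity
along the integers. Combined with the entropy estimate, this shows that a normalised function has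
positive energy. -/
theorem lintegral_rpow_eq_zero_of_forall_scale (hd : 0 < d) (hu : Measurable u) {c : ℝ}
    (hc : 0 < c) (h : ∀ r : ℝ, 0 < r →
      ∫⁻ x, ENNReal.ofReal (|u x| ^ p * Real.log (|u x| ^ p / (c / r ^ d))) = 0) :
    ∫⁻ x, ENNReal.ofReal (|u x| ^ p) = 0 := by
  have hae : ∀ᵐ x, ∀ n : ℕ, |u x| ^ p ≤ c / (n + 1 : ℝ) ^ d := by
    rw [ae_all_iff]
    intro n
    have hm : Measurable fun x => ENNReal.ofReal
        (|u x| ^ p * Real.log (|u x| ^ p / (c / (n + 1 : ℝ) ^ d))) := by fun_prop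
    filter_upwards [(lintegral_eq_zero_iff hm).mp (h (n + 1) (by positivity))] with x hx
    simp only [Pi.zero_apply, ENNReal.ofReal_eq_zero] at hx
    by_contra! hlt
    have hT : 0 < c / (n + 1 : ℝ) ^ d := by positivity
    exact absurd hx (not_le.mpr (mul_pos (hT.trans hlt)
      (Real.log_pos ((one_lt_div hT).mpr hlt))))
  rw [lintegral_eq_zero_iff (by fun_prop)]
  filter_upwards [hae] with x hx
  have hlim : Tendsto (fun n : ℕ => c / (n + 1 : ℝ) ^ d) atTop (𝓝 0) :=
    tendsto_const_nhds.div_atTop ((tendsto_pow_atTop hd.ne').comp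
      (tendsto_atTop_add_const_right _ _ tendsto_natCast_atTop_atTop))
  simpa using ge_of_tendsto' hlim hx

/-- Choosing the scale `r` with `r ^ (s p) = (s (1 - s) E)⁻¹` in the entropy estimate. -/
theorem log_scale_add_le {s c C E δ : ℝ} (hp : 1 < p) (hδ : 0 < δ) (hs0 : 0 < s) (hs1 : s < 1) (hsp : s * p < δ) (hE : 0 < E) :
    (Real.log c - δ * Real.log ((s * (1 - s) * E) ^ (-(s * p)⁻¹))) / p + C / (s * p) ≤
      δ / (s * p ^ 2) * Real.log (δ ^ (p - 1) * Real.exp (|Real.log c| + C * p / δ) *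
        (s * (1 - s) / (δ - s * p) ^ (p - 1)) * E) := by
  have hs' : 0 < 1 - s := by linarith
  have hx : 0 < s * (1 - s) * E := by positivity
  have hδs : 0 < δ - s * p := by linarith
  have hsplit : δ ^ (p - 1) * Real.exp (|Real.log c| + C * p / δ) *
      (s * (1 - s) / (δ - s * p) ^ (p - 1)) * E =
      (δ / (δ - s * p)) ^ (p - 1) * Real.exp (|Real.log c| + C * p / δ) * (s * (1 - s) * E) := by
    rw [Real.div_rpow hδ.le hδs.le]
    ring
  -- The factor `δ ^ (p - 1)` in the constant makes this ratio at least one, so it can only increase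
  -- the right-hand side.
  have hratio : 0 ≤ Real.log ((δ / (δ - s * p)) ^ (p - 1)) := by
    refine Real.log_nonneg (Real.one_le_rpow ?_ (by linarith))
    rw [one_le_div hδs]
    nlinarith
  have hpos : 0 < (δ / (δ - s * p)) ^ (p - 1) := by positivity
  rw [hsplit, Real.log_mul (by positivity) hx.ne', Real.log_mul hpos.ne' (Real.exp_ne_zero _),
    Real.log_exp, Real.log_rpow hx]
  set ℓ := Real.log (s * (1 - s) * E)
  -- Since `s p < δ`, the prefactor `δ / (s p)` exceeds one and absorbs `log c`, whatever its sign.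
  have hkey : Real.log c ≤ δ / (s * p) * |Real.log c| := by
    have h1 : 1 ≤ δ / (s * p) := by rw [one_le_div (by positivity)]; exact hsp.le
    nlinarith [le_abs_self (Real.log c), abs_nonneg (Real.log c)]
  have hlhs : (Real.log c - δ * (-(s * p)⁻¹ * ℓ)) / p + C / (s * p) =
      Real.log c / p + δ / (s * p ^ 2) * ℓ + C / (s * p) := by
    field_simp
    ring
  have hrhs : δ / (s * p ^ 2) * (Real.log ((δ / (δ - s * p)) ^ (p - 1)) +
      (|Real.log c| + C * p / δ) + ℓ) =
      δ / (s * p ^ 2) * Real.log ((δ / (δ - s * p)) ^ (p - 1)) +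
      δ / (s * p) * |Real.log c| / p + C / (s * p) + δ / (s * p ^ 2) * ℓ := by
    field_simp
    ring
  rw [hlhs, hrhs]
  have h2 : Real.log c / p ≤ δ / (s * p) * |Real.log c| / p := by gcongr
  have h3 : 0 ≤ δ / (s * p ^ 2) * Real.log ((δ / (δ - s * p)) ^ (p - 1)) := by positivity
  linarith

end

/-! ### The logarithmic Sobolev inequality -/

theorem theorem1p1 (d : ℕ) (p : ℝ) (hp : 1 < p) :
    ∃ C : ℝ, 0 < C ∧
      ∀ s : ℝ, 0 < s → s < 1 → s * p < (d : ℝ) →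
        ∀ u : EuclideanSpace ℝ (Fin d) → ℝ, MemFracSobolev s p u →
          (∫ x, |u x| ^ p) = 1 →
            -- both sides are meaningful
            0 < gagliardoEnergy s p u ∧ gagliardoEnergy s p u < ⊤ ∧
            (∫⁻ x, ENNReal.ofReal (|u x| ^ p * Real.log |u x|)) < ⊤ ∧
            -- the inequality (the left-hand side may be `-∞`)
            extIntegral (fun x => |u x| ^ p * Real.log |u x|) ≤
              (((d : ℝ) / (s * p ^ 2) *
                Real.log (C * (s * (1 - s) / ((d : ℝ) - s * p) ^ (p - 1)) *
                  (gagliardoEnergy s p u).toReal) : ℝ) : EReal) := by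
  rcases Nat.eq_zero_or_pos d with rfl | hd
  · refine ⟨1, one_pos, fun s hs0 _ hsp => ?_⟩
    rw [Nat.cast_zero] at hsp
    exact absurd hsp (not_lt.mpr (by positivity))
  have hd0 : (0 : ℝ) < d := by exact_mod_cast hd
  obtain ⟨c, C, hc, hC, hmain⟩ := exists_lintegral_mul_log_le hd hp
  -- The power of `d` compensates `(d - s p) ^ (p - 1)`; the exponential absorbs `log c` and the
  -- error `C / (s p) = d / (s p ^ 2) * (C p / d)`.
  refine ⟨(d : ℝ) ^ (p - 1) * Real.exp (|Real.log c| + C * p / d), by positivity, ?_⟩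
  intro s hs0 hs1 hsp u hmem hint
  have hfin := hmem.gagliardoEnergy_lt_top hd hp hs0 hs1
  obtain ⟨v, hv, huv⟩ : ∃ v : EuclideanSpace ℝ (Fin d) → ℝ, Measurable v ∧ u =ᵐ[volume] v :=
    ⟨hmem.1.1.mk u, hmem.1.1.stronglyMeasurable_mk.measurable, hmem.1.1.ae_eq_mk⟩
  have hcongr : ∀ F : ℝ → ℝ≥0∞, ∫⁻ x, F (u x) = ∫⁻ x, F (v x) := fun F =>
    lintegral_congr_ae (huv.mono fun x hx => by simp only [hx])
  have hone : ∫⁻ x, ENNReal.ofReal (|v x| ^ p) = 1 := by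
    have hae : (fun x => |u x| ^ p) =ᵐ[volume] fun x => |v x| ^ p :=
      huv.mono fun x hx => by simp only [hx]
    -- The value one excludes an infinite integral, for which `toReal` would return zero.
    rw [integral_congr_ae hae, integral_eq_lintegral_of_nonneg_ae
      (ae_of_all _ fun x => by positivity)
      (Measurable.aestronglyMeasurable (by fun_prop)), ENNReal.toReal_eq_one_iff] at hint
    exact hint
  have hext : extIntegral (fun x => |u x| ^ p * Real.log |u x|) =
      extIntegral (fun x => |v x| ^ p * Real.log |v x|) := by
    unfold extIntegral
    rw [hcongr fun t => ENNReal.ofReal (|t| ^ p * Real.log |t|),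
      hcongr fun t => ENNReal.ofReal (-(|t| ^ p * Real.log |t|))]
  rw [hext, hcongr fun t => ENNReal.ofReal (|t| ^ p * Real.log |t|)]
  rw [gagliardoEnergy_congr_ae s huv] at hfin ⊢
  have hest := hmain s hs0 hs1 v hv hone
  have hEpos : 0 < gagliardoEnergy s p v := by
    rw [pos_iff_ne_zero]
    intro hE
    refine one_ne_zero (hone.symm.trans (lintegral_rpow_eq_zero_of_forall_scale hd hv hc ?_))
    intro r hr
    simpa [hE] using hest r hr
  set E := (gagliardoEnergy s p v).toReal with hE
  have hE0 : 0 < E := ENNReal.toReal_pos hEpos.ne' hfin.ne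
  have hs' : 0 < 1 - s := by linarith
  have hx : 0 < s * (1 - s) * E := by positivity
  -- At this scale the error term `C * (1 - s) * r ^ (s * p) * E` no longer depends on `E`.
  set r := (s * (1 - s) * E) ^ (-(s * p)⁻¹) with hr
  have hr0 : 0 < r := by positivity
  have hrpow : C * (1 - s) * r ^ (s * p) * E = C / s := by
    rw [hr, ← Real.rpow_mul hx.le, neg_mul, inv_mul_cancel₀ (by positivity), Real.rpow_neg_one]
    field_simp
  have hT : 0 < c / r ^ d := by positivity
  have hgK : ∫⁻ x, ENNReal.ofReal (p⁻¹ * (|v x| ^ p * Real.log (|v x| ^ p / (c / r ^ d)))) ≤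
      ENNReal.ofReal (C / (s * p)) := by
    simp only [ENNReal.ofReal_mul (inv_nonneg.mpr (zero_le_one.trans hp.le))]
    rw [lintegral_const_mul' _ _ ENNReal.ofReal_ne_top]
    refine (mul_le_mul_right (hest r hr0) _).trans (le_of_eq ?_)
    rw [← ENNReal.ofReal_toReal hfin.ne, ← hE, ← ENNReal.ofReal_mul (by positivity), hrpow,
      ← ENNReal.ofReal_mul (by positivity)]
    congr 1
    field_simp
  obtain ⟨hlt, hle⟩ := extIntegral_le_of_eq_add (by positivity) (fun x => by positivity)
    (by fun_prop) (by fun_prop) (fun x => rpow_mul_log_eq hp hT) hone hgK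
  refine ⟨hEpos, hfin, hlt, hle.trans (EReal.coe_le_coe_iff.mpr ?_)⟩
  have hlogT : Real.log (c / r ^ d) = Real.log c - d * Real.log r := by
    rw [Real.log_div hc.ne' (by positivity), Real.log_pow]
  rw [hlogT]
  exact log_scale_add_le hp hd0 hs0 hs1 hsp hE0
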